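/- Let $G=(V,E)$ be the complete undirected graph on a finite nonempty vertex set $V$, let $c\colon E\to\mathbb{R}_{\ge 0}$ be metric edge costs (i.e. $c$ satisfies the triangle inequality), and let $d_1,\dots,d_k\in V$ be pairwise distinct; put $d_{k+1}:=d_1$. For $S\subseteq V$ let $\delta(S)$ be the set of edges with exactly one endpoint in $S$, let $\delta(v):=\delta(\{v\})$, and for $F\subseteq E$ write $c(F)=\sum_{e\in F}c_e$ and $x(F)=\sum_{e\in F}x_e$. For $s,t\in V$ let $P_{s\text{-}t}(G)$ be the set of all $(x,y)\in\mathbb{R}_{\ge0}^E\times\mathbb{R}_{\ge0}^V$ such that $$\begin{array}{ll} x(\delta(v))=2y_v & \text{for all } v\in V,\\ x(\delta(S))\ge 1 & \text{for all } S\subseteq V\setminus\{t\} \text{ with } s\in S,\\ x(\delta(S))\ge 2y_v & \text{for all } S\subseteq V\setminus\{s,t\} \text{ and } v\in S,\\ y_s=y_t=\tfrac12. & \end{array}$$ Let $c_{\mathrm{LP}}$ be the optimal objective value of the linear program $$\min\Big\{\sum_{e\in E}c_e\sum_{i=1}^k x^i_e \;:\; \sum_{i=1}^k y^i_v=1\ \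 \forall v\in V,\quad (x^i,y^i)\in P_{d_i\text{-}d_{i+1}}(G)\ \ \forall i\in\{1,\dots,k\}\Big\},$$ where $k$ is such that the program has an optimal solution (this is the case if and only if $k\ge 2$; for $k\le 1$ the program is infeasible). Then: 1. A minimum-cost spanning tree $T$ of $G$ exists, and every such $T$ satisfies $c(T)\le c_{\mathrm{LP}}$. 2. For every $Q\subseteq V$ of even cardinality, a minimum-cost $Q$-join $J$ (a set $J\subseteq E$ whose vertices of odd degree are exactly the elements of $Q$) exists, and every such $J$ satisfies $c(J)\le\frac12 c_{\mathrm{LP}}$. -/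

import Mathlib

namespace OTSP

section

variable {V : Type*} [Fintype V] [DecidableEq V]

/-- The edge set `E` of the complete undirected graph on `V`. Vectors in `ℝ^E` are written as
functions on `Sym2 V`, of which only the values on `E` are ever used. -/
abbrev edges (V : Type*) [Fintype V] [DecidableEq V] : Finset (Sym2 V) :=
  (⊤ : SimpleGraph V).edgeFinset

/-- The set `δ(S)` of edges with exactly one endpoint in `S`. -/
def cut (S : Finset V) : Finset (Sym2 V) :=
  {e ∈ edges V | ∃ u ∈ S, ∃ v ∉ S, e = s(u, v)}

/-- Metric edge costs on the complete graph: nonnegative on edges, with the triangle inequality. -/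
structure IsMetricCost (c : Sym2 V → ℝ) : Prop where
  nonneg : ∀ e ∈ edges V, 0 ≤ c e
  triangle : ∀ u v w : V, u ≠ v → v ≠ w → u ≠ w → c s(u, w) ≤ c s(u, v) + c s(v, w)

/-- Membership of `(x, y)` in the `s`-`t` stroll polyhedron of the complete graph on `V`. -/
structure InStroll (s t : V) (x : Sym2 V → ℝ) (y : V → ℝ) : Prop where
  x_nonneg : ∀ e ∈ edges V, 0 ≤ x e
  y_nonneg : ∀ v, 0 ≤ y v
  degree : ∀ v, ∑ e ∈ cut {v}, x e = 2 * y v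
  cut_sep : ∀ S : Finset V, s ∈ S → t ∉ S → 1 ≤ ∑ e ∈ cut S, x e
  cut_cover : ∀ S : Finset V, s ∉ S → t ∉ S → ∀ v ∈ S, 2 * y v ≤ ∑ e ∈ cut S, x e
  y_source : y s = 1 / 2
  y_target : y t = 1 / 2

/-- Feasibility of `(xⁱ, yⁱ)ᵢ` for the OTSP LP relaxation. The successor of `dᵢ` is taken
cyclically: `finRotate k` sends `i` to `i + 1` and the last index to the first. -/
structure LPFeasible {k : ℕ} (d : Fin k → V) (x : Fin k → Sym2 V → ℝ) (y : Fin k → V → ℝ) :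
    Prop where
  coverage : ∀ v, ∑ i, y i v = 1
  stroll : ∀ i, InStroll (d i) (d (finRotate k i)) (x i) (y i)

/-- The LP objective. -/
def lpObjective (c : Sym2 V → ℝ) {k : ℕ} (x : Fin k → Sym2 V → ℝ) : ℝ :=
  ∑ e ∈ edges V, c e * ∑ i, x i e

/-- `r` is the optimal (that is, minimum) objective value of the OTSP LP relaxation. -/
def IsLPOptimum (c : Sym2 V → ℝ) {k : ℕ} (d : Fin k → V) (r : ℝ) : Prop :=
  IsLeast {z | ∃ x y, LPFeasible d x y ∧ lpObjective c x = z} r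

/-- Cost of a set of edges. -/
def cost (c : Sym2 V → ℝ) (F : Finset (Sym2 V)) : ℝ := ∑ e ∈ F, c e

/-- `T` is the edge set of a spanning tree of the complete graph on `V`. -/
def IsSpanningTree (T : Finset (Sym2 V)) : Prop :=
  T ⊆ edges V ∧ (SimpleGraph.fromEdgeSet (T : Set (Sym2 V))).IsTree

/-- `T` is a spanning tree of minimum cost. -/
def IsShortestSpanningTree (c : Sym2 V → ℝ) (T : Finset (Sym2 V)) : Prop :=
  IsSpanningTree T ∧ ∀ T', IsSpanningTree T' → cost c T ≤ cost c T'

/-- `J` is a `Q`-join: a set of edges whose odd-degree vertices are exactly those in `Q`. -/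
def IsJoin (Q : Finset V) (J : Finset (Sym2 V)) : Prop :=
  J ⊆ edges V ∧ ∀ v, Odd {e ∈ J | v ∈ e}.card ↔ v ∈ Q

/-- `J` is a `Q`-join of minimum cost. -/
def IsShortestJoin (c : Sym2 V → ℝ) (Q : Finset V) (J : Finset (Sym2 V)) : Prop :=
  IsJoin Q J ∧ ∀ J', IsJoin Q J' → cost c J ≤ cost c J'

end

end OTSP

/-! Let x be the sum of the stroll vectors of an optimal solution. The core fact is x(δ(S)) ≥ 2 for
every nonempty proper S (`LPFeasible.two_le_sum_cut`); both bounds follow from it.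

Trees: Kruskal's algorithm read as a dual argument. With κ components, the cut bounds give total
weight at least κ on the edges between components. Adding a cheapest such edge and subtracting its
cost from all of them leaves a smaller instance (`exists_connecting_set`).

Joins: x/2 covers every cut δ(S) with |Q ∩ S| odd, so it suffices that a shortest Q-join costs no
more than any fractional cover of these cuts (`IsShortestJoin.cost_le`). For integer costs that are
even on closed edge sets, `exists_reducible_cut` finds such a cut on which costs can drop by 1 while
the optimum drops by at most 1; any cover loses at least 1. Iterating reaches optimum 0. Real costs
are reduced to this case by scaling and rounding. -/

namespace OTSP

open Finset
open scoped symmDiff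

/-! ### Parity calculus of edge sets under symmetric difference -/

section Join

variable {V : Type*} [Fintype V] [DecidableEq V]

/-- The set of vertices of odd degree of an edge set. -/
def oddVerts (J : Finset (Sym2 V)) : Finset V := {v | Odd #{e ∈ J | v ∈ e}}

theorem mem_oddVerts {J : Finset (Sym2 V)} {v : V} : v ∈ oddVerts J ↔ Odd #{e ∈ J | v ∈ e} := by
  simp [oddVerts]

theorem isJoin_iff {Q : Finset V} {J : Finset (Sym2 V)} :
    IsJoin Q J ↔ J ⊆ edges V ∧ oddVerts J = Q := by
  simp [IsJoin, Finset.ext_iff, mem_oddVerts]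

theorem odd_card_symmDiff {α : Type*} [DecidableEq α] (A B : Finset α) :
    Odd #(A ∆ B) ↔ ¬ (Odd #A ↔ Odd #B) := by
  have h1 := card_union_of_disjoint (disjoint_sdiff_sdiff (x := A) (y := B))
  have h2 := card_sdiff_add_card_inter A B
  have h3 := card_sdiff_add_card_inter B A
  rw [inter_comm B A] at h3
  have h4 : A ∆ B = A \ B ∪ B \ A := rfl
  rw [h4, h1, Nat.odd_iff, Nat.odd_iff, Nat.odd_iff]
  omega

theorem oddVerts_symmDiff (J K : Finset (Sym2 V)) :
    oddVerts (J ∆ K) = oddVerts J ∆ oddVerts K := by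
  ext v
  have : ({e ∈ J ∆ K | v ∈ e} : Finset _) = {e ∈ J | v ∈ e} ∆ {e ∈ K | v ∈ e} := by
    ext e; simp only [mem_filter, mem_symmDiff]; tauto
  rw [mem_oddVerts, this, odd_card_symmDiff, mem_symmDiff, mem_oddVerts, mem_oddVerts]
  tauto

@[simp]
theorem oddVerts_empty : oddVerts (∅ : Finset (Sym2 V)) = ∅ := by
  ext; simp [mem_oddVerts]

theorem oddVerts_singleton {a b : V} (h : a ≠ b) : oddVerts {s(a, b)} = {a} ∆ {b} := by
  ext v
  rw [mem_oddVerts, filter_singleton, mem_symmDiff]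
  by_cases ha : v = a <;> by_cases hb : v = b <;> simp_all

@[simp]
theorem mk_mem_edges {a b : V} : s(a, b) ∈ edges V ↔ a ≠ b := by
  simp [edges]

theorem mk_mem_cut {S : Finset V} {a b : V} : s(a, b) ∈ cut S ↔ ¬ (a ∈ S ↔ b ∈ S) := by
  simp only [cut, mem_filter, mk_mem_edges]
  constructor
  · rintro ⟨-, u, hu, v, hv, h⟩
    rcases Sym2.eq_iff.1 h with ⟨rfl, rfl⟩ | ⟨rfl, rfl⟩ <;> tauto
  · intro h
    refine ⟨fun hab => h (by rw [hab]), ?_⟩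
    by_cases ha : a ∈ S
    · exact ⟨a, ha, b, by tauto, rfl⟩
    · exact ⟨b, by tauto, a, ha, Sym2.eq_swap⟩

theorem cut_subset_edges (S : Finset V) : cut S ⊆ edges V := filter_subset _ _

theorem cut_compl (S : Finset V) : cut Sᶜ = cut S := by
  ext e
  induction e using Sym2.ind with
  | _ a b => rw [mk_mem_cut, mk_mem_cut, mem_compl, mem_compl]; tauto

theorem exists_of_mem_cut {S : Finset V} {e : Sym2 V} (h : e ∈ cut S) :
    ∃ u ∈ S, ∃ v ∉ S, e = s(u, v) := (mem_filter.1 h).2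

theorem symmDiff_subset {α : Type*} [DecidableEq α] {A B E : Finset α} (hA : A ⊆ E) (hB : B ⊆ E) :
    A ∆ B ⊆ E :=
  symmDiff_le_sup.trans (sup_le hA hB)

/-- Both sides are additive mod 2 in `J`, so the handshake argument reduces to a single edge. -/
theorem odd_card_inter_cut {J : Finset (Sym2 V)} (hJ : J ⊆ edges V) (S : Finset V) :
    Odd #(J ∩ cut S) ↔ Odd #(oddVerts J ∩ S) := by
  induction J using Finset.induction_on with
  | empty => simp
  | insert e J he ih =>
    have h : insert e J = {e} ∆ J := by
      rw [insert_eq, (disjoint_singleton_left.2 he).symmDiff_eq_sup]; rfl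
    rw [insert_subset_iff] at hJ
    have hd : ∀ A B C : Finset (Sym2 V), (A ∆ B) ∩ C = (A ∩ C) ∆ (B ∩ C) :=
      fun A B C => inf_symmDiff_distrib_right A B C
    have hd' : ∀ A B C : Finset V, (A ∆ B) ∩ C = (A ∩ C) ∆ (B ∩ C) :=
      fun A B C => inf_symmDiff_distrib_right A B C
    rw [h, oddVerts_symmDiff, hd, hd', odd_card_symmDiff, odd_card_symmDiff, ih hJ.2]
    suffices Odd #({e} ∩ cut S) ↔ Odd #(oddVerts {e} ∩ S) by rw [this]
    obtain ⟨he', -⟩ := hJ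
    induction e using Sym2.ind with
    | _ a b =>
      rw [oddVerts_singleton (mk_mem_edges.1 he'), hd', odd_card_symmDiff, singleton_inter,
        singleton_inter, singleton_inter]
      simp only [mk_mem_cut]
      by_cases ha : a ∈ S <;> by_cases hb : b ∈ S <;> simp [ha, hb]

theorem exists_join {Q : Finset V} (hQ : Even #Q) : ∃ J ⊆ edges V, oddVerts J = Q := by
  induction hn : #Q using Nat.strong_induction_on generalizing Q with
  | _ n ih =>
    rcases Q.eq_empty_or_nonempty with rfl | ⟨a, ha⟩
    · exact ⟨∅, empty_subset _, oddVerts_empty⟩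
    have h1 : (Q.erase a).Nonempty := by
      rw [← card_pos, card_erase_of_mem ha]
      have := card_pos.2 ⟨a, ha⟩
      rcases hQ with ⟨r, hr⟩
      omega
    obtain ⟨b, hb⟩ := h1
    have hc := card_erase_of_mem hb
    rw [card_erase_of_mem ha] at hc
    have hp := card_pos.2 ⟨a, ha⟩
    have hp' := card_pos.2 ⟨b, hb⟩
    rw [card_erase_of_mem ha] at hp'
    obtain ⟨J, hJ, hJQ⟩ := ih #((Q.erase a).erase b) (by omega)
      (by rw [hc]; rcases hQ with ⟨r, hr⟩; exact ⟨r - 1, by omega⟩) rfl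
    have hab : a ≠ b := fun h => by simp [h] at hb
    refine ⟨J ∆ {s(a, b)}, symmDiff_subset hJ (by simpa using hab), ?_⟩
    rw [oddVerts_symmDiff, hJQ, oddVerts_singleton hab]
    ext v
    simp only [mem_symmDiff, mem_erase, mem_singleton]
    have hbQ := (mem_erase.1 hb).2
    by_cases h1 : v = a <;> by_cases h2 : v = b <;> simp_all

/-- If `v` is the only vertex outside `B` of odd degree in `J`, then `J` contains a path from `v`
to `B` that crosses the boundary of `B` once. -/
theorem exists_path_to {B : Finset V} {J : Finset (Sym2 V)} {v : V} (hJ : J ⊆ edges V)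
    (hv : v ∉ B) (h : ∀ x ∉ B, x ∈ oddVerts J ↔ x = v) :
    ∃ w ∈ B, ∃ D ⊆ J, oddVerts D = {v} ∆ {w} ∧ #(D ∩ cut B) = 1 := by
  induction hn : #J generalizing J v with
  | zero =>
    rw [card_eq_zero] at hn
    subst hn
    simpa using (h v hv).2 rfl
  | succ n ih =>
    have hodd := mem_oddVerts.1 ((h v hv).2 rfl)
    obtain ⟨e, he⟩ := card_pos.1 hodd.pos
    obtain ⟨heJ, hve⟩ := mem_filter.1 he
    obtain ⟨u, rfl⟩ := Sym2.mem_iff_exists.1 hve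
    have hvu : v ≠ u := mk_mem_edges.1 (hJ heJ)
    by_cases hu : u ∈ B
    · refine ⟨u, hu, {s(v, u)}, by simpa using heJ, oddVerts_singleton hvu, ?_⟩
      rw [singleton_inter_of_mem (by rw [mk_mem_cut]; tauto), card_singleton]
    -- Deleting the edge `vu` moves the odd vertex from `v` to `u`; neither endpoint is in `B`, so
    -- no crossing is used up.
    · have hsd : J.erase s(v, u) = J ∆ {s(v, u)} := by
        ext f; simp only [mem_erase, mem_symmDiff, mem_singleton]
        by_cases hf : f = s(v, u) <;> simp_all
      obtain ⟨w, hw, D, hD, hDw, hDc⟩ := ih (J := J.erase s(v, u)) (v := u)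
        ((erase_subset _ _).trans hJ) hu (by
          intro x hx
          rw [hsd, oddVerts_symmDiff, oddVerts_singleton hvu]
          simp only [mem_symmDiff, mem_singleton, h x hx]
          by_cases h1 : x = v <;> by_cases h2 : x = u <;> simp_all)
        (by rw [card_erase_of_mem heJ]; omega)
      have hnot : s(v, u) ∉ D := fun h => by simpa using hD h
      refine ⟨w, hw, {s(v, u)} ∆ D, symmDiff_subset (by simpa using heJ)
        (hD.trans (erase_subset _ _)), ?_, ?_⟩
      · rw [oddVerts_symmDiff, hDw, oddVerts_singleton hvu, symmDiff_assoc,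
          symmDiff_symmDiff_cancel_left]
      · rw [← hDc]
        congr 1
        ext f
        simp only [mem_inter, mem_symmDiff, mem_singleton]
        by_cases hf : f = s(v, u)
        · subst hf; simp only [mk_mem_cut]; tauto
        · simp [hf]

theorem sum_symmDiff_le {α : Type*} [DecidableEq α] (c : α → ℕ) (A B : Finset α) :
    ∑ e ∈ A ∆ B, c e ≤ ∑ e ∈ A, c e + ∑ e ∈ B, c e := by
  rw [← sum_union_inter]
  exact (sum_le_sum_of_subset symmDiff_le_sup).trans (Nat.le_add_right _ _)

/-- Each element of `C` lies in exactly one of `A`, `B`, and toggling moves it to the other: an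
exchange preserves total cost. -/
theorem sum_symmDiff_add_sum_symmDiff {α : Type*} [Fintype α] [DecidableEq α] (c : α → ℕ)
    {A B C : Finset α} (h : C ⊆ A ∆ B) :
    ∑ e ∈ A ∆ C, c e + ∑ e ∈ B ∆ C, c e = ∑ e ∈ A, c e + ∑ e ∈ B, c e := by
  have key : ∀ S : Finset α, ∑ e ∈ S, c e = ∑ e, if e ∈ S then c e else 0 := by
    intro S; rw [sum_ite_mem, univ_inter]
  simp only [key]
  rw [← sum_add_distrib, ← sum_add_distrib]
  refine sum_congr rfl fun e _ => ?_
  have := @h e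
  simp only [mem_symmDiff] at this ⊢
  by_cases h1 : e ∈ A <;> by_cases h2 : e ∈ B <;> by_cases h3 : e ∈ C <;> simp_all

theorem even_sum_symmDiff {α : Type*} [DecidableEq α] (c : α → ℕ) (A B : Finset α)
    (h : Even (∑ e ∈ A ∆ B, c e)) : (∑ e ∈ A, c e) % 2 = (∑ e ∈ B, c e) % 2 := by
  have h1 := sum_sdiff (f := c) (inter_subset_left (s₁ := A) (s₂ := B))
  have h2 := sum_sdiff (f := c) (inter_subset_right (s₁ := A) (s₂ := B))
  rw [sdiff_inter_self_left] at h1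
  rw [sdiff_inter_self_right] at h2
  have h4 : A ∆ B = A \ B ∪ B \ A := rfl
  rw [h4, sum_union disjoint_sdiff_sdiff, Nat.even_iff] at h
  omega

end Join

/-! ### Shortest joins versus fractional covers of odd cuts -/

section CutReduction

variable {V : Type*} [Fintype V] [DecidableEq V]

/-- There is an edge set of cost zero joining `u` and `v`. -/
def ZeroJoined (c : Sym2 V → ℕ) (u v : V) : Prop :=
  ∃ Z ⊆ edges V, oddVerts Z = {u} ∆ {v} ∧ ∑ e ∈ Z, c e = 0

theorem ZeroJoined.refl (c : Sym2 V → ℕ) (u : V) : ZeroJoined c u u :=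
  ⟨∅, empty_subset _, by simp, by simp⟩

theorem ZeroJoined.symm {c : Sym2 V → ℕ} {u v : V} (h : ZeroJoined c u v) : ZeroJoined c v u := by
  obtain ⟨Z, hZ, hb, h0⟩ := h
  exact ⟨Z, hZ, by rw [hb, symmDiff_comm], h0⟩

theorem ZeroJoined.trans {c : Sym2 V → ℕ} {u v w : V} (h : ZeroJoined c u v)
    (h' : ZeroJoined c v w) : ZeroJoined c u w := by
  obtain ⟨Z, hZ, hb, h0⟩ := h
  obtain ⟨Z', hZ', hb', h0'⟩ := h'
  refine ⟨Z ∆ Z', symmDiff_subset hZ hZ', ?_, ?_⟩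
  · rw [oddVerts_symmDiff, hb, hb', symmDiff_assoc, symmDiff_symmDiff_cancel_left]
  · have := sum_symmDiff_le c Z Z'
    omega

theorem zeroJoined_of_eq_zero {c : Sym2 V → ℕ} {u v : V} (huv : u ≠ v) (h : c s(u, v) = 0) :
    ZeroJoined c u v :=
  ⟨{s(u, v)}, by simpa using huv, oddVerts_singleton huv, by simpa using h⟩

theorem one_le_of_mem_cut {c : Sym2 V → ℕ} {b : V} {B : Finset V}
    (hB : ∀ v, v ∈ B ↔ ZeroJoined c b v) {e : Sym2 V} (he : e ∈ cut B) : 1 ≤ c e := by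
  obtain ⟨u, hu, v, hv, rfl⟩ := exists_of_mem_cut he
  by_contra hlt
  have huv : u ≠ v := fun h => hv (h ▸ hu)
  exact hv ((hB v).2 (((hB u).1 hu).trans (zeroJoined_of_eq_zero huv (by omega))))

/-- Cost functions for which every closed edge set has even cost. -/
def EvenOnCycles (c : Sym2 V → ℕ) : Prop :=
  ∀ C ⊆ edges V, oddVerts C = ∅ → Even (∑ e ∈ C, c e)

theorem EvenOnCycles.mod_two_eq {c : Sym2 V → ℕ} (hc : EvenOnCycles c) {J K : Finset (Sym2 V)}
    (hJ : J ⊆ edges V) (hK : K ⊆ edges V) (h : oddVerts J = oddVerts K) :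
    (∑ e ∈ J, c e) % 2 = (∑ e ∈ K, c e) % 2 :=
  even_sum_symmDiff c J K (hc _ (symmDiff_subset hJ hK) (by
    rw [oddVerts_symmDiff, h, symmDiff_self]; rfl))

/-- An edge set `H` whose only odd vertex outside `B` is `a` and that crosses the boundary of `B` at
least twice contains a path between two vertices of `B` that crosses the boundary exactly twice. -/
theorem exists_ear {B : Finset V} {H : Finset (Sym2 V)} {a : V} (hH : H ⊆ edges V) (ha : a ∉ B)
    (hodd : ∀ x ∉ B, x ∈ oddVerts H ↔ x = a) (hcard : 2 ≤ #(H ∩ cut B)) :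
    ∃ w ∈ B, ∃ w' ∈ B, ∃ C ⊆ H, oddVerts C = {w} ∆ {w'} ∧ #(C ∩ cut B) = 2 := by
  -- The path from `a` uses only one crossing. Once it is removed, another crossing edge `wu`
  -- remains; deleting that too leaves `u` as the only odd vertex outside `B`, from which a path
  -- returns to `B`.
  obtain ⟨w₀, hw₀, D₀, hD₀, hbD₀, hcD₀⟩ := exists_path_to hH ha hodd
  have hne : ((H \ D₀) ∩ cut B).Nonempty := by
    rw [← card_pos]
    have h1 : (H \ D₀) ∩ cut B = (H ∩ cut B) \ (D₀ ∩ cut B) := by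
      ext e; simp only [mem_inter, mem_sdiff]; tauto
    rw [h1]
    have := le_card_sdiff (D₀ ∩ cut B) (H ∩ cut B)
    omega
  obtain ⟨e, he⟩ := hne
  obtain ⟨heH, heB⟩ := mem_inter.1 he
  obtain ⟨w, hw, u, hu, rfl⟩ := exists_of_mem_cut heB
  have hwu : w ≠ u := fun h => hu (h ▸ hw)
  have hset : (H \ D₀).erase s(w, u) = (H ∆ D₀) ∆ {s(w, u)} := by
    ext f
    have := @hD₀ f
    simp only [mem_erase, mem_sdiff, mem_symmDiff, mem_singleton] at heH ⊢
    by_cases hf : f = s(w, u)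
    · subst hf; tauto
    · tauto
  obtain ⟨w', hw', D, hD, hbD, hcD⟩ := exists_path_to (B := B) (J := (H \ D₀).erase s(w, u)) (v := u)
    (((erase_subset _ _).trans sdiff_subset).trans hH) hu (by
      intro x hx
      rw [hset, oddVerts_symmDiff, oddVerts_symmDiff, oddVerts_singleton hwu, hbD₀]
      simp only [mem_symmDiff, mem_singleton, hodd x hx]
      have h1 : x ≠ w₀ := fun h => hx (h ▸ hw₀)
      have h2 : x ≠ w := fun h => hx (h ▸ hw)
      tauto)
  have hnot : s(w, u) ∉ D := fun h => by simpa using hD h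
  refine ⟨w, hw, w', hw', {s(w, u)} ∆ D, symmDiff_subset
    (by simpa using (mem_sdiff.1 heH).1) (hD.trans ((erase_subset _ _).trans sdiff_subset)), ?_, ?_⟩
  · rw [oddVerts_symmDiff, oddVerts_singleton hwu, hbD, symmDiff_assoc,
      symmDiff_symmDiff_cancel_left]
  · have : ({s(w, u)} ∆ D) ∩ cut B = insert s(w, u) (D ∩ cut B) := by
      ext f
      simp only [mem_inter, mem_symmDiff, mem_singleton, mem_insert]
      by_cases hf : f = s(w, u)
      · subst hf; tauto
      · tauto
    rw [this, card_insert_of_notMem (fun h => hnot (mem_inter.1 h).1), hcD]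

theorem symmDiff_telescope {α : Type*} [BooleanAlgebra α] (q a b x y : α) :
    ((q ∆ (a ∆ b)) ∆ (x ∆ y)) ∆ (b ∆ x) = q ∆ (a ∆ y) := by
  rw [symmDiff_comm x y, symmDiff_comm b x, symmDiff_assoc (q ∆ (a ∆ b)), symmDiff_assoc y x,
    symmDiff_symmDiff_cancel_left, symmDiff_comm y b, symmDiff_assoc q, symmDiff_assoc a b,
    symmDiff_symmDiff_cancel_left]

/-- If the minimum cost of a `Q`-join is positive, there is a set `B` with `|Q ∩ B|` odd such that
lowering all costs on the boundary of `B` by one lowers the minimum cost of a `Q`-join by at most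
one. -/
theorem exists_reducible_cut {c : Sym2 V → ℕ} (hc : EvenOnCycles c) {Q : Finset V}
    {J : Finset (Sym2 V)} (hJ : J ⊆ edges V) (hJQ : oddVerts J = Q)
    (hmin : ∀ J' ⊆ edges V, oddVerts J' = Q → ∑ e ∈ J, c e ≤ ∑ e ∈ J', c e)
    (hpos : 0 < ∑ e ∈ J, c e) :
    ∃ B : Finset V, Odd #(Q ∩ B) ∧ (∀ e ∈ cut B, 1 ≤ c e) ∧
      ∀ J' ⊆ edges V, oddVerts J' = Q →
        ∑ e ∈ J, c e + #(J' ∩ cut B) ≤ ∑ e ∈ J', c e + 1 := by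
  classical
  have hinter : ∀ X Y Z : Finset (Sym2 V), (X ∆ Y) ∩ Z = (X ∩ Z) ∆ (Y ∩ Z) :=
    fun X Y Z => inf_symmDiff_distrib_right X Y Z
  obtain ⟨f, hfJ, hf⟩ := exists_ne_zero_of_sum_ne_zero hpos.ne'
  -- `L` is cheapest over all pairs `a`, `b` at once, so its endpoints may be changed in later
  -- comparisons.
  obtain ⟨L, hL, hLmin⟩ := exists_min_image
    {L ∈ (edges V).powerset | ∃ a b, oddVerts L = Q ∆ ({a} ∆ {b})} (fun L => ∑ e ∈ L, c e)
    (by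
      induction f using Sym2.ind with
      | _ u v => exact ⟨J, by simp only [mem_filter, mem_powerset]; exact ⟨hJ, u, u, by
        rw [hJQ, symmDiff_self, symmDiff_bot]⟩⟩)
  simp only [mem_filter, mem_powerset] at hL hLmin
  obtain ⟨hLE, a, b, hLb⟩ := hL
  -- Removing the positive-cost edge `f` from `J` gives a competitor of `L`.
  have hlt : ∑ e ∈ L, c e < ∑ e ∈ J, c e := by
    have hfE := hJ hfJ
    induction f using Sym2.ind with
    | _ u v =>
      have huv : u ≠ v := mk_mem_edges.1 hfE
      have hset : J.erase s(u, v) = J ∆ {s(u, v)} := by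
        ext e; simp only [mem_erase, mem_symmDiff, mem_singleton]
        by_cases h : e = s(u, v) <;> simp_all
      have h1 := hLmin (J.erase s(u, v)) ⟨(erase_subset _ _).trans hJ, u, v, by
        rw [hset, oddVerts_symmDiff, hJQ, oddVerts_singleton huv]⟩
      have h2 := add_sum_erase J c hfJ
      omega
  let B : Finset V := {v | ZeroJoined c b v}
  have hB : ∀ v, v ∈ B ↔ ZeroJoined c b v := fun v => by simp [B]
  have hb : b ∈ B := (hB b).2 (ZeroJoined.refl c b)
  have ha : a ∉ B := by
    intro ha
    obtain ⟨Z, hZ, hZb, hZ0⟩ := (hB a).1 ha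
    have h1 := hmin (L ∆ Z) (symmDiff_subset hLE hZ) (by
      rw [oddVerts_symmDiff, hLb, hZb, symmDiff_comm ({b} : Finset V), symmDiff_symmDiff_cancel_right])
    have h2 := sum_symmDiff_le c L Z
    omega
  have hone : ∀ e ∈ cut B, 1 ≤ c e := fun e he => one_le_of_mem_cut hB he
  -- Replace a crossing edge `xy` of `L'` by a free connection from `b` to `x`: the endpoint `b`
  -- becomes `y` and the cost drops by at least 1. Parity of costs turns this gap of 1 into 2.
  have htouch : ∀ L' ⊆ edges V, oddVerts L' = Q ∆ ({a} ∆ {b}) → (L' ∩ cut B).Nonempty →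
      ∑ e ∈ L, c e + 2 ≤ ∑ e ∈ L', c e := by
    rintro L' hL' hL'b ⟨e, he⟩
    obtain ⟨heL, heB⟩ := mem_inter.1 he
    have he1 := hone e heB
    obtain ⟨x, hx, y, hy, rfl⟩ := exists_of_mem_cut heB
    have hxy : x ≠ y := fun h => hy (h ▸ hx)
    obtain ⟨Z, hZ, hZb, hZ0⟩ := (hB x).1 hx
    have hset : L'.erase s(x, y) = L' ∆ {s(x, y)} := by
      ext e; simp only [mem_erase, mem_symmDiff, mem_singleton]
      by_cases h : e = s(x, y) <;> simp_all
    have h1 := hLmin (L'.erase s(x, y) ∆ Z)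
      ⟨symmDiff_subset ((erase_subset _ _).trans hL') hZ, a, y, by
        rw [oddVerts_symmDiff, hset, oddVerts_symmDiff, oddVerts_singleton hxy, hZb, hL'b,
          symmDiff_telescope]⟩
    have h2 := sum_symmDiff_le c (L'.erase s(x, y)) Z
    have h3 := add_sum_erase L' c heL
    have h4 := hc.mod_two_eq hLE hL' (hLb.trans hL'b.symm)
    omega
  have hLB : L ∩ cut B = ∅ := by
    by_contra h
    have := htouch L hLE hLb (nonempty_iff_ne_empty.2 h)
    omega
  have hQB : Odd #(Q ∩ B) := by
    have h1 := odd_card_inter_cut hLE B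
    have hd : ∀ X Y Z : Finset V, (X ∆ Y) ∩ Z = (X ∩ Z) ∆ (Y ∩ Z) :=
      fun X Y Z => inf_symmDiff_distrib_right X Y Z
    rw [hLB, hLb, hd, hd, odd_card_symmDiff, odd_card_symmDiff, singleton_inter_of_mem hb,
      singleton_inter_of_notMem ha] at h1
    simpa using h1
  refine ⟨B, hQB, hone, ?_⟩
  intro J' hJ' hJ'Q
  induction hr : #(J' ∩ cut B) using Nat.strong_induction_on generalizing J' with
  | _ r ih =>
    have hodd : Odd r := by rw [← hr, odd_card_inter_cut hJ', hJ'Q]; exact hQB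
    rcases Nat.lt_or_ge r 2 with hr2 | hr2
    · have := hmin J' hJ' hJ'Q
      omega
    -- With at least two crossings, `J' ∆ L` contains an ear `C`, closed up inside cost zero by `Z`.
    -- Toggling both removes two crossings from `J'` but makes `L` touch the cut, raising its cost
    -- by at least 2; the exchange identity then makes `J'` cheaper by at least 2.
    have hHB : (J' ∆ L) ∩ cut B = J' ∩ cut B := by
      rw [hinter, hLB]; exact symmDiff_bot _
    obtain ⟨w, hw, w', hw', C, hC, hCb, hCB⟩ := exists_ear (symmDiff_subset hJ' hLE) ha (by
      intro x hx
      rw [oddVerts_symmDiff, hJ'Q, hLb, symmDiff_symmDiff_cancel_left]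
      have : x ≠ b := fun h => hx (h ▸ hb)
      simp only [mem_symmDiff, mem_singleton]
      tauto) (by rw [hHB, hr]; exact hr2)
    obtain ⟨Z, hZ, hZb, hZ0⟩ := ((hB w).1 hw).symm.trans ((hB w').1 hw')
    have hZB : Z ∩ cut B = ∅ := by
      rw [← disjoint_iff_inter_eq_empty, disjoint_left]
      intro e heZ heB
      have h1 := hone e heB
      have h2 := (sum_eq_zero_iff.1 hZ0) e heZ
      omega
    have hCE : C ⊆ edges V := hC.trans (symmDiff_subset hJ' hLE)
    have hCJ : C ∩ cut B ⊆ J' ∩ cut B := by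
      rw [← hHB]; exact inter_subset_inter_right hC
    have hbd : ∀ X, oddVerts ((X ∆ C) ∆ Z) = oddVerts X := by
      intro X
      rw [oddVerts_symmDiff, oddVerts_symmDiff, hCb, hZb, symmDiff_symmDiff_cancel_right]
    have hJcut : #(((J' ∆ C) ∆ Z) ∩ cut B) = r - 2 := by
      rw [hinter, hinter, hZB, ← hr, ← hCB, ← card_sdiff_of_subset hCJ]
      congr 1
      ext e
      have := @hCJ e
      simp only [mem_symmDiff, mem_sdiff, notMem_empty]
      tauto
    have hLcut : ((L ∆ C) ∆ Z) ∩ cut B = C ∩ cut B := by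
      rw [hinter, hinter, hZB, hLB]
      ext e
      simp only [mem_symmDiff, notMem_empty]
      tauto
    have h1 := ih (r - 2) (by omega) ((J' ∆ C) ∆ Z)
      (symmDiff_subset (symmDiff_subset hJ' hCE) hZ) ((hbd _).trans hJ'Q) hJcut
    have h2 := htouch ((L ∆ C) ∆ Z) (symmDiff_subset (symmDiff_subset hLE hCE) hZ)
      ((hbd _).trans hLb) (by rw [hLcut, ← card_pos]; omega)
    have h3 := sum_symmDiff_add_sum_symmDiff c hC
    have h4 := sum_symmDiff_le c (J' ∆ C) Z
    have h5 := sum_symmDiff_le c (L ∆ C) Z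
    omega

theorem sum_eq_sum_sub_add_card {α : Type*} [DecidableEq α] {c : α → ℕ} {D : Finset α}
    (h : ∀ e ∈ D, 1 ≤ c e) (S : Finset α) :
    ∑ e ∈ S, c e = ∑ e ∈ S, (c e - if e ∈ D then 1 else 0) + #(S ∩ D) := by
  rw [card_eq_sum_ones, ← sum_ite_mem, ← sum_add_distrib]
  refine sum_congr rfl fun e _ => ?_
  have := h e
  split_ifs with h <;> simp_all

/-- Induction on total cost, lowering a reducible cut by 1. Closed sets cross a cut evenly, so
evenness on closed sets survives. -/
theorem exists_join_sum_le_of_evenOnCycles {Q : Finset V} (hQ : Even #Q) {z : Sym2 V → ℝ}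
    (hz : ∀ e ∈ edges V, 0 ≤ z e) (hcut : ∀ S : Finset V, Odd #(Q ∩ S) → 1 ≤ ∑ e ∈ cut S, z e)
    (c : Sym2 V → ℕ) (hc : EvenOnCycles c) :
    ∃ J ⊆ edges V, oddVerts J = Q ∧ ((∑ e ∈ J, c e : ℕ) : ℝ) ≤ ∑ e ∈ edges V, c e * z e := by
  induction hn : ∑ e ∈ edges V, c e using Nat.strong_induction_on generalizing c with
  | _ n ih =>
    obtain ⟨J, hJ, hmin⟩ := exists_min_image
      {J ∈ (edges V).powerset | oddVerts J = Q} (fun J => ∑ e ∈ J, c e)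
      (by
        obtain ⟨J, hJ, hJQ⟩ := exists_join hQ
        exact ⟨J, by simp only [mem_filter, mem_powerset]; exact ⟨hJ, hJQ⟩⟩)
    simp only [mem_filter, mem_powerset] at hJ hmin
    obtain ⟨hJ, hJQ⟩ := hJ
    refine ⟨J, hJ, hJQ, ?_⟩
    rcases Nat.eq_zero_or_pos (∑ e ∈ J, c e) with h0 | hpos
    · rw [h0, Nat.cast_zero]
      exact sum_nonneg fun e he => mul_nonneg (Nat.cast_nonneg _) (hz e he)
    obtain ⟨B, hQB, hone, hB⟩ := exists_reducible_cut hc hJ hJQ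
      (fun J' h h' => hmin J' ⟨h, h'⟩) hpos
    have hsplit := sum_eq_sum_sub_add_card hone
    obtain ⟨J', hJ', hJ'Q, hle⟩ := ih (∑ e ∈ edges V, (c e - if e ∈ cut B then 1 else 0)) (by
        have h1 : 0 < #(J ∩ cut B) := by
          have h2 := (odd_card_inter_cut hJ B).2 (by rw [hJQ]; exact hQB)
          exact h2.pos
        have h2 := card_le_card (inter_subset_inter hJ (subset_refl (cut B)))
        have h3 := hsplit (edges V)
        omega)
      (fun e => c e - if e ∈ cut B then 1 else 0) (by
        intro C hC hC0
        have h1 := hc C hC hC0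
        have h2 := odd_card_inter_cut hC B
        rw [hC0, empty_inter, card_empty] at h2
        rw [hsplit C, Nat.even_add] at h1
        exact h1.2 (by rw [← Nat.not_odd_iff_even, h2]; decide)) rfl
    have h1 := hB J' hJ' hJ'Q
    rw [hsplit J'] at h1
    have h2 : ∑ e ∈ J, c e ≤ ∑ e ∈ J', (c e - if e ∈ cut B then 1 else 0) + 1 := by omega
    have h3 : ((∑ e ∈ J, c e : ℕ) : ℝ) ≤
        ((∑ e ∈ J', (c e - if e ∈ cut B then 1 else 0) : ℕ) : ℝ) + 1 := by exact_mod_cast h2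
    have h4 : ∑ e ∈ edges V, (c e : ℝ) * z e =
        ∑ e ∈ edges V, ((c e - if e ∈ cut B then 1 else 0 : ℕ) : ℝ) * z e +
          ∑ e ∈ cut B, z e := by
      rw [← inter_eq_right.2 (cut_subset_edges B), ← sum_ite_mem, inter_eq_right.2 (cut_subset_edges B),
        ← sum_add_distrib]
      refine sum_congr rfl fun e _ => ?_
      split_ifs with h
      · rw [Nat.cast_sub (hone e h)]; push_cast; ring
      · simp
    have h5 := hcut B hQB
    linarith

/-- The cost of a shortest `Q`-join is at most the cost of any fractional vector covering all cuts
`δ(S)` with `|Q ∩ S|` odd. -/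
theorem IsShortestJoin.cost_le {c : Sym2 V → ℝ} (hc : ∀ e ∈ edges V, 0 ≤ c e) {Q : Finset V}
    (hQ : Even #Q) {J : Finset (Sym2 V)} (hJ : IsShortestJoin c Q J) {z : Sym2 V → ℝ}
    (hz : ∀ e ∈ edges V, 0 ≤ z e) (hcut : ∀ S : Finset V, Odd #(Q ∩ S) → 1 ≤ ∑ e ∈ cut S, z e) :
    cost c J ≤ ∑ e ∈ edges V, c e * z e := by
  by_contra! hlt
  -- `N` makes the supposed gap, once scaled, exceed the total rounding error, which is at most 1
  -- per edge. The factor 2 in the rounded costs supplies the evenness.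
  obtain ⟨N, hN⟩ := exists_nat_gt ((#(edges V) : ℝ) / (cost c J - ∑ e ∈ edges V, c e * z e))
  rw [div_lt_iff₀ (sub_pos.2 hlt)] at hN
  obtain ⟨J', hJ', hJ'Q, hle⟩ := exists_join_sum_le_of_evenOnCycles hQ hz hcut
    (fun e => 2 * ⌊N * c e⌋₊) (fun C _ _ => by rw [← mul_sum]; exact even_two_mul _)
  have h1 := hJ.2 J' (isJoin_iff.2 ⟨hJ', hJ'Q⟩)
  have h2 : N * cost c J' ≤ ∑ e ∈ J', (⌊N * c e⌋₊ : ℝ) + #(edges V) := by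
    have : (#J' : ℝ) ≤ #(edges V) := by exact_mod_cast card_le_card hJ'
    refine le_trans ?_ (add_le_add_right this _)
    rw [card_eq_sum_ones, Nat.cast_sum, ← sum_add_distrib, cost, mul_sum]
    refine sum_le_sum fun e _ => ?_
    have := Nat.lt_floor_add_one (N * c e)
    push_cast
    linarith
  have h3 : ∑ e ∈ edges V, ((2 * ⌊N * c e⌋₊ : ℕ) : ℝ) * z e ≤
      2 * (N * ∑ e ∈ edges V, c e * z e) := by
    rw [mul_sum, mul_sum]
    refine sum_le_sum fun e he => ?_
    have h4 := mul_le_mul_of_nonneg_right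
      (Nat.floor_le (mul_nonneg (Nat.cast_nonneg N) (hc e he))) (hz e he)
    push_cast
    linarith
  have h4 := hle.trans h3
  rw [← mul_sum] at h4
  push_cast at h4
  have h5 : (N : ℝ) * cost c J ≤ N * cost c J' := mul_le_mul_of_nonneg_left h1 (Nat.cast_nonneg N)
  linarith

end CutReduction

/-! ### The cut bound for LP solutions -/

section LPBound

variable {V : Type*} [Fintype V] [DecidableEq V]

open scoped Fin.NatCast Fin.CommRing in
-- Rotation acts transitively: `j` is reached from `i` in `j - i` steps.
theorem forall_of_finRotate_closed {k : ℕ} {p : Fin k → Prop}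
    (h : ∀ i, p i → p (finRotate k i)) {i : Fin k} (hi : p i) (j : Fin k) : p j := by
  cases k with
  | zero => exact i.elim0
  | succ n =>
    have key : ∀ m : ℕ, p (i + (m : Fin (n + 1))) := by
      intro m
      induction m with
      | zero => simpa using hi
      | succ m ih =>
        have := h _ ih
        rwa [finRotate_apply, add_assoc, ← Nat.cast_succ] at this
    have := key (j - i).val
    rwa [Fin.cast_val_eq_self, add_sub_cancel] at this

/-- If `S` or its complement has no terminal, sum the covering constraints at one vertex of that
side. Otherwise the cyclic tour of terminals leaves `S` at one index and enters it at another, and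
each of these strolls contributes 1. -/
theorem LPFeasible.two_le_sum_cut {k : ℕ} {d : Fin k → V} {x : Fin k → Sym2 V → ℝ}
    {y : Fin k → V → ℝ} (h : LPFeasible d x y) {S : Finset V} (hS : S.Nonempty) (hS' : S ≠ univ) :
    2 ≤ ∑ e ∈ cut S, ∑ i, x i e := by
  have hnone : ∀ S : Finset V, S.Nonempty → (∀ i, d i ∉ S) → 2 ≤ ∑ e ∈ cut S, ∑ i, x i e := by
    rintro S ⟨v, hv⟩ hdS
    rw [sum_comm]
    calc (2 : ℝ) = ∑ i, 2 * y i v := by rw [← mul_sum, h.coverage, mul_one]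
      _ ≤ _ := sum_le_sum fun i _ => (h.stroll i).cut_cover S (hdS _) (hdS _) v hv
  by_cases h1 : ∀ i, d i ∉ S
  · exact hnone S hS h1
  by_cases h2 : ∀ i, d i ∈ S
  · rw [← cut_compl]
    refine hnone Sᶜ ?_ fun i => by simpa using h2 i
    rwa [nonempty_iff_ne_empty, Ne, compl_eq_empty_iff]
  push Not at h1 h2
  obtain ⟨i₁, hi₁⟩ := h1
  obtain ⟨i₂, hi₂⟩ := h2
  obtain ⟨j₁, hj₁, hj₁'⟩ : ∃ j, d j ∈ S ∧ d (finRotate k j) ∉ S := by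
    by_contra! hcon
    exact hi₂ (forall_of_finRotate_closed (p := fun i => d i ∈ S) hcon hi₁ i₂)
  obtain ⟨j₂, hj₂, hj₂'⟩ : ∃ j, d j ∉ S ∧ d (finRotate k j) ∈ S := by
    by_contra! hcon
    exact forall_of_finRotate_closed (p := fun i => d i ∉ S) hcon hi₂ i₁ hi₁
  have hne : j₁ ≠ j₂ := fun hj => hj₂ (hj ▸ hj₁)
  have b1 := (h.stroll j₁).cut_sep S hj₁ hj₁'
  have b2 := (h.stroll j₂).cut_sep Sᶜ (by simpa using hj₂) (by simpa using hj₂')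
  rw [cut_compl] at b2
  rw [sum_comm]
  calc (2 : ℝ) ≤ ∑ i ∈ {j₁, j₂}, ∑ e ∈ cut S, x i e := by rw [sum_pair hne]; linarith
    _ ≤ _ := sum_le_sum_of_subset_of_nonneg (subset_univ _) fun i _ _ =>
      sum_nonneg fun e he => (h.stroll i).x_nonneg e (cut_subset_edges S he)

end LPBound

/-! ### Spanning trees versus the fractional cut bound -/

section SpanningTree

variable {V : Type*} [Fintype V] [DecidableEq V]

open Classical in
/-- The edges joining different components of a graph. -/
noncomputable def crossing (G : SimpleGraph V) : Finset (Sym2 V) :=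
  {e ∈ edges V | ∃ u v, e = s(u, v) ∧ ¬ G.Reachable u v}

theorem mk_mem_crossing {G : SimpleGraph V} {u v : V} :
    s(u, v) ∈ crossing G ↔ ¬ G.Reachable u v := by
  simp only [crossing, mem_filter, mk_mem_edges]
  constructor
  · rintro ⟨-, a, b, h, hab⟩
    rcases Sym2.eq_iff.1 h with ⟨rfl, rfl⟩ | ⟨rfl, rfl⟩
    · exact hab
    · exact fun h => hab h.symm
  · intro h
    refine ⟨?_, u, v, rfl, h⟩
    rintro rfl
    exact h (SimpleGraph.Reachable.refl _)

theorem crossing_subset_edges (G : SimpleGraph V) : crossing G ⊆ edges V := by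
  classical exact filter_subset _ _

theorem crossing_anti {G H : SimpleGraph V} (h : G ≤ H) : crossing H ⊆ crossing G := by
  intro e
  induction e using Sym2.ind with
  | _ u v =>
    rw [mk_mem_crossing, mk_mem_crossing]
    exact fun h1 h2 => h1 (h2.mono h)

/-- Sum the cut bound over all components; each crossing edge lies in at most two of these cuts. -/
theorem card_components_le_sum_crossing {x : Sym2 V → ℝ} (hx : ∀ e ∈ edges V, 0 ≤ x e)
    (hcut : ∀ S : Finset V, S.Nonempty → S ≠ univ → 2 ≤ ∑ e ∈ cut S, x e) {G : SimpleGraph V}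
    (hG : ¬ G.Preconnected) : (Nat.card G.ConnectedComponent : ℝ) ≤ ∑ e ∈ crossing G, x e := by
  classical
  let S : G.ConnectedComponent → Finset V := fun C => {v | G.connectedComponentMk v = C}
  have hS : ∀ C v, v ∈ S C ↔ G.connectedComponentMk v = C := fun C v => by simp [S]
  have hsub : ∀ C, cut (S C) ⊆ crossing G := by
    intro C e he
    obtain ⟨u, hu, v, hv, rfl⟩ := exists_of_mem_cut he
    rw [mk_mem_crossing]
    intro h
    rw [hS] at hu hv
    exact hv (by rw [← hu, SimpleGraph.ConnectedComponent.eq]; exact h.symm)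
  have h1 : ∀ C, 2 ≤ ∑ e ∈ cut (S C), x e := by
    intro C
    refine hcut _ ?_ ?_
    · induction C using SimpleGraph.ConnectedComponent.ind with
      | _ v => exact ⟨v, (hS _ _).2 rfl⟩
    · intro h
      refine hG fun u v => ?_
      rw [← SimpleGraph.ConnectedComponent.eq, (hS C u).1 (h ▸ mem_univ u),
        (hS C v).1 (h ▸ mem_univ v)]
  have h2 : ∑ C, ∑ e ∈ cut (S C), x e ≤ ∑ e ∈ crossing G, 2 * x e := by
    have : ∀ C, ∑ e ∈ cut (S C), x e =
        ∑ e ∈ crossing G, if e ∈ cut (S C) then x e else 0 := by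
      intro C
      rw [sum_ite_mem, inter_eq_right.2 (hsub C)]
    simp only [this]
    rw [sum_comm]
    refine sum_le_sum fun e he => ?_
    have hxe := hx e (crossing_subset_edges G he)
    rw [← sum_filter, sum_const, nsmul_eq_mul]
    refine mul_le_mul_of_nonneg_right ?_ hxe
    induction e using Sym2.ind with
    | _ u v =>
      have : ({C | s(u, v) ∈ cut (S C)} : Finset _) ⊆
          {G.connectedComponentMk u, G.connectedComponentMk v} := by
        intro C
        simp only [mem_filter, mem_univ, true_and, mk_mem_cut, hS, mem_insert, mem_singleton]
        intro h
        by_cases h' : G.connectedComponentMk u = C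
        · exact Or.inl h'.symm
        · exact Or.inr (by tauto)
      exact_mod_cast (card_le_card this).trans card_le_two
  have h3 : ∑ _C : G.ConnectedComponent, (2 : ℝ) ≤ ∑ C, ∑ e ∈ cut (S C), x e :=
    sum_le_sum fun C _ => h1 C
  rw [sum_const, nsmul_eq_mul, card_univ, ← Nat.card_eq_fintype_card] at h3
  rw [← mul_sum] at h2
  linarith

/-- Any edge set `F` can be extended to a connected one by adding at most `κ - 1` edges, where `κ`
is the number of components, at no more than the fractional cost of the crossing edges. -/
theorem exists_connecting_set [Nonempty V] {x : Sym2 V → ℝ} (hx : ∀ e ∈ edges V, 0 ≤ x e)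
    (hcut : ∀ S : Finset V, S.Nonempty → S ≠ univ → 2 ≤ ∑ e ∈ cut S, x e)
    (F : Finset (Sym2 V)) (c : Sym2 V → ℝ)
    (hc : ∀ e ∈ crossing (SimpleGraph.fromEdgeSet (F : Set (Sym2 V))), 0 ≤ c e) :
    ∃ T ⊆ edges V,
      (SimpleGraph.fromEdgeSet ((F ∪ T : Finset (Sym2 V)) : Set (Sym2 V))).Connected ∧
      #T + 1 ≤ Nat.card (SimpleGraph.fromEdgeSet (F : Set (Sym2 V))).ConnectedComponent ∧
      ∑ e ∈ T, c e ≤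
        ∑ e ∈ crossing (SimpleGraph.fromEdgeSet (F : Set (Sym2 V))), c e * x e := by
  classical
  induction hn : Nat.card (SimpleGraph.fromEdgeSet (F : Set (Sym2 V))).ConnectedComponent
    using Nat.strong_induction_on generalizing F c with
  | _ n ih =>
    set G := SimpleGraph.fromEdgeSet (F : Set (Sym2 V)) with hGdef
    have hnpos : 0 < n := hn ▸ Nat.card_pos
    by_cases hG : G.Preconnected
    · refine ⟨∅, empty_subset _, ⟨by simpa using hG⟩, by simp; omega, ?_⟩
      rw [sum_empty]
      exact sum_nonneg fun e he => mul_nonneg (hc e he) (hx e (crossing_subset_edges G he))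
    have hκ := card_components_le_sum_crossing hx hcut hG
    rw [hn] at hκ
    have hne : (crossing G).Nonempty := by
      simp only [SimpleGraph.Preconnected, not_forall] at hG
      obtain ⟨u, v, huv⟩ := hG
      exact ⟨s(u, v), mk_mem_crossing.2 huv⟩
    obtain ⟨f, hf, hfmin⟩ := exists_min_image (crossing G) c hne
    set G' := SimpleGraph.fromEdgeSet ((insert f F : Finset (Sym2 V)) : Set (Sym2 V)) with hG'def
    have hle : G ≤ G' := SimpleGraph.fromEdgeSet_mono (by simp)
    have hanti := crossing_anti hle
    have hlt : Nat.card G'.ConnectedComponent < n := by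
      rw [← hn, Nat.card_eq_fintype_card, Nat.card_eq_fintype_card]
      refine Fintype.card_lt_of_surjective_not_injective
        (SimpleGraph.ConnectedComponent.map (SimpleGraph.Hom.ofLE hle)) ?_ ?_
      · intro C
        induction C using SimpleGraph.ConnectedComponent.ind with
        | _ v => exact ⟨G.connectedComponentMk v, rfl⟩
      · intro hinj
        have hfE := crossing_subset_edges G hf
        induction f using Sym2.ind with
        | _ u v =>
          refine mk_mem_crossing.1 hf (SimpleGraph.ConnectedComponent.eq.1 (hinj ?_))
          change G'.connectedComponentMk u = G'.connectedComponentMk v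
          rw [SimpleGraph.ConnectedComponent.eq]
          refine SimpleGraph.Adj.reachable ?_
          rw [hG'def, SimpleGraph.fromEdgeSet_adj]
          exact ⟨by simp, mk_mem_edges.1 hfE⟩
    -- Minimality of `f` keeps the reduced costs nonnegative on crossing edges. The reduction
    -- undercounts `T` together with `f` by `c f * (#T + 1)`, which is paid by the fractional
    -- weight, at least κ, of the crossing edges.
    obtain ⟨T, hT, hconn, hcard, hcost⟩ := ih _ hlt (insert f F) (fun e => c e - c f)
      (fun e he => sub_nonneg.2 (hfmin e (hanti he))) rfl
    refine ⟨insert f T, insert_subset (crossing_subset_edges G hf) hT, ?_, ?_, ?_⟩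
    · have : F ∪ insert f T = insert f F ∪ T := by
        rw [union_insert, insert_union]
      rwa [this]
    · have := card_insert_le f T
      omega
    · have hf0 := hc f hf
      have h1 : ∑ e ∈ insert f T, c e ≤ ∑ e ∈ T, c e + c f := by
        by_cases hfT : f ∈ T
        · rw [insert_eq_of_mem hfT]; linarith
        · rw [sum_insert hfT]; linarith
      have h2 : ∑ e ∈ crossing G', (c e - c f) * x e ≤ ∑ e ∈ crossing G, (c e - c f) * x e :=
        sum_le_sum_of_subset_of_nonneg hanti fun e he _ =>
          mul_nonneg (sub_nonneg.2 (hfmin e he)) (hx e (crossing_subset_edges G he))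
      simp only [sub_mul, sum_sub_distrib, ← mul_sum] at h2 hcost
      rw [sum_const, nsmul_eq_mul] at hcost
      have h3 : ((#T : ℝ) + 1) ≤ n := by exact_mod_cast hcard.trans hlt.le
      have h4 : c f * (#T + 1) ≤ c f * ∑ e ∈ crossing G, x e :=
        mul_le_mul_of_nonneg_left (h3.trans hκ) hf0
      linarith

theorem exists_spanningTree_cost_le [Nonempty V] {c x : Sym2 V → ℝ} (hc : ∀ e ∈ edges V, 0 ≤ c e)
    (hx : ∀ e ∈ edges V, 0 ≤ x e)
    (hcut : ∀ S : Finset V, S.Nonempty → S ≠ univ → 2 ≤ ∑ e ∈ cut S, x e) :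
    ∃ T, IsSpanningTree T ∧ cost c T ≤ ∑ e ∈ edges V, c e * x e := by
  obtain ⟨T, hT, hconn, hcard, hcost⟩ := exists_connecting_set hx hcut ∅ c
    (fun e he => hc e (crossing_subset_edges _ he))
  rw [empty_union] at hconn
  refine ⟨T, ⟨hT, ?_⟩, hcost.trans ?_⟩
  -- Starting from no edges there are at most |V| components, so `T` has at most |V| - 1 edges; a
  -- connected graph that sparse is a tree.
  · rw [SimpleGraph.isTree_iff_connected_and_card]
    refine ⟨hconn, le_antisymm ?_ hconn.card_vert_le_card_edgeSet_add_one⟩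
    have h1 : Nat.card (SimpleGraph.fromEdgeSet (T : Set (Sym2 V))).edgeSet ≤ #T := by
      rw [Nat.card_coe_set_eq, SimpleGraph.edgeSet_fromEdgeSet, ← Set.ncard_coe_finset]
      exact Set.ncard_le_ncard Set.sdiff_subset T.finite_toSet
    have h2 := Nat.card_le_card_of_surjective
      (SimpleGraph.fromEdgeSet ((∅ : Finset (Sym2 V)) : Set (Sym2 V))).connectedComponentMk
      Quot.mk_surjective
    omega
  · exact sum_le_sum_of_subset_of_nonneg (crossing_subset_edges _) fun e he _ =>
      mul_nonneg (hc e he) (hx e he)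

end SpanningTree

/-! ### Minimisers over finite families -/

section Existence

variable {V : Type*} [Fintype V] [DecidableEq V]

theorem exists_shortestSpanningTree {c : Sym2 V → ℝ} (h : ∃ T : Finset (Sym2 V), IsSpanningTree T) :
    ∃ T, IsShortestSpanningTree c T := by
  classical
  obtain ⟨T, hT⟩ := h
  obtain ⟨T', hT', hmin⟩ := exists_min_image {T : Finset (Sym2 V) | IsSpanningTree T} (cost c)
    ⟨T, by simpa using hT⟩
  exact ⟨T', by simpa using hT', fun T'' h => hmin T'' (by simpa using h)⟩

theorem exists_shortestJoin {c : Sym2 V → ℝ} {Q : Finset V} (hQ : Even #Q) :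
    ∃ J, IsShortestJoin c Q J := by
  classical
  obtain ⟨J, hJ, hJQ⟩ := exists_join hQ
  obtain ⟨J', hJ', hmin⟩ := exists_min_image {J : Finset (Sym2 V) | IsJoin Q J} (cost c)
    ⟨J, by simpa using isJoin_iff.2 ⟨hJ, hJQ⟩⟩
  exact ⟨J', by simpa using hJ', fun J'' h => hmin J'' (by simpa using h)⟩

end Existence

end OTSP

theorem mainTheorem5 {V : Type*} [Fintype V] [DecidableEq V] [Nonempty V]
    (c : Sym2 V → ℝ) (hc : OTSP.IsMetricCost c)
    {k : ℕ} (d : Fin k → V) (hd : Function.Injective d)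
    (cLP : ℝ) (hLP : OTSP.IsLPOptimum c d cLP) :
    ((∃ T, OTSP.IsShortestSpanningTree c T) ∧
      ∀ T, OTSP.IsShortestSpanningTree c T → OTSP.cost c T ≤ cLP) ∧
    (∀ Q : Finset V, Even Q.card →
      (∃ J, OTSP.IsShortestJoin c Q J) ∧
        ∀ J, OTSP.IsShortestJoin c Q J → OTSP.cost c J ≤ 1 / 2 * cLP) := by
  obtain ⟨⟨x, y, hxy, rfl⟩, -⟩ := hLP
  have hx : ∀ e ∈ OTSP.edges V, 0 ≤ ∑ i, x i e := fun e he =>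
    Finset.sum_nonneg fun i _ => (hxy.stroll i).x_nonneg e he
  have hcut : ∀ S : Finset V, S.Nonempty → S ≠ Finset.univ →
      2 ≤ ∑ e ∈ OTSP.cut S, ∑ i, x i e := fun S h h' => hxy.two_le_sum_cut h h'
  obtain ⟨T₀, hT₀, hcost⟩ := OTSP.exists_spanningTree_cost_le hc.nonneg hx hcut
  refine ⟨⟨OTSP.exists_shortestSpanningTree ⟨T₀, hT₀⟩, fun T hT => (hT.2 T₀ hT₀).trans hcost⟩,
    fun Q hQ => ⟨OTSP.exists_shortestJoin hQ, fun J hJ => ?_⟩⟩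
  refine (hJ.cost_le hc.nonneg hQ (z := fun e => 1 / 2 * ∑ i, x i e)
    (fun e he => mul_nonneg (by norm_num) (hx e he)) ?_).trans ?_
  -- Neither `∅` nor, since |Q| is even, all of `V` meets `Q` in an odd set, so the cut bound
  -- applies.
  · intro S hS
    have h1 := hcut S
      (by
        rw [Finset.nonempty_iff_ne_empty]
        rintro rfl
        simp at hS)
      (by
        rintro rfl
        rw [Finset.inter_univ] at hS
        exact Nat.not_odd_iff_even.2 hQ hS)
    rw [← Finset.mul_sum]
    linarith
  · rw [OTSP.lpObjective, Finset.mul_sum]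
    exact Finset.sum_le_sum fun e _ => le_of_eq (by ring)
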